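/- Let $\zeta$ be the Riemann zeta function. For every complex number $s$ that is not an integer $\le 1$, $$\zeta(s)=\frac{\pi^{s/2}}{2(s-1)\,\Gamma(1+s/2)}\prod_{\operatorname{Im}\rho>0}\Bigl\{\Bigl(1-\frac{s}{\rho}\Bigr)\Bigl(1-\frac{s}{1-\rho}\Bigr)\Bigr\},$$ where $\rho$ runs through the zeros of $\zeta$ with positive imaginary part, each repeated according to its multiplicity. The factors are the bracketed products, and the infinite product converges unconditionally, that is, its finite partial products converge to the same value in every order of the factors. -/

import Mathlib

/-- The non-real zeros of the Riemann zeta function in the upper half-plane, as a set. -/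
def upperZetaZeros : Set ℂ := {ρ | riemannZeta ρ = 0 ∧ 0 < ρ.im}

/-- The index type of the zeros of `ζ` with positive imaginary part, counted with multiplicity:
a zero `ρ` of order `m` contributes the `m` indices `⟨ρ, 0⟩, …, ⟨ρ, m - 1⟩`. -/
abbrev UpperZetaZeroIndex : Type :=
  Σ ρ : upperZetaZeros, Fin (analyticOrderNatAt riemannZeta (ρ : ℂ))

/-- The factor `(1 - s/ρ) (1 - s/(1-ρ))`. -/
noncomputable def zetaZeroFactor (s ρ : ℂ) : ℂ := (1 - s / ρ) * (1 - s / (1 - ρ))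

/-!
The entire function `ξ(s) = s (s - 1) Λ(s)` satisfies `ξ(1 - s) = ξ(s)`, so `ξ(s) = h(s (1 - s))`
with `h` entire and `h 0 = 1`. The order of `h` is less than one, and Hadamard's theorem then gives
`h(z) = ∏ (1 - z / a)` over the zeros `a` of `h`. For `a = ρ (1 - ρ)` and `z = s (1 - s)` the factor
`1 - z / a` is `(1 - s / ρ) (1 - s / (1 - ρ))`.

Growth: `Λ₀` is the Mellin transform of a nonnegative function, so in a vertical strip `|Λ₀|` is at
most the sum of its values at the real points of the two edges. The edges `2k` and `1 - 2k`, where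
`Λ₀` is `O(k!)`, give `|Λ₀(s)| ≤ exp(C |s|^{3/2})` and hence `|h(z)| ≤ exp(C |z|^{3/4})`.

Hadamard's theorem for order `α < 1`: divide `f` by its zeros in the disc of radius `R`. The maximum
principle on the disc of radius `4R` bounds both the number of zeros and the cofactor `g` by the
growth of `f`; as `g` has no zeros in the smaller disc, the Borel–Carathéodory inequality gives
`log g(z) = O(R^{α - 1})`, which tends to `0`.

Zeros: `ξ` has no real zeros, because `|Λ₀| < 4` and `x (1 - x) ≤ 1/4` on `[0, 1]`. Hence
`ρ ↦ ρ (1 - ρ)` maps the zeros of `ζ` in the upper half-plane bijectively onto those of `h`, and it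
preserves multiplicities since its derivative vanishes only at `1/2`.
-/

open Filter Topology Metric

/-! ### Dividing out the zeros of an entire function -/

theorem exists_eq_pow_mul_of_analyticOrderAt_eq {f : ℂ → ℂ} (hf : Differentiable ℂ f) {b : ℂ}
    {m : ℕ} (hm : analyticOrderAt f b = m) :
    ∃ q : ℂ → ℂ, Differentiable ℂ q ∧ q b ≠ 0 ∧ ∀ z, f z = (z - b) ^ m * q z := by
  induction m generalizing f with
  | zero =>
    exact ⟨f, hf, (hf.analyticAt b).analyticOrderAt_eq_zero.1 hm, fun z => by simp⟩
  | succ m ih =>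
    have hfb : f b = 0 := apply_eq_zero_of_analyticOrderAt_ne_zero (by simp [hm])
    have hslope : Differentiable ℂ (dslope f b) :=
      differentiableOn_univ.1 ((Complex.differentiableOn_dslope univ_mem).2 hf.differentiableOn)
    have hfactor (z : ℂ) : f z = (z - b) * dslope f b z := by
      simpa [hfb] using (sub_smul_dslope f b z).symm
    have horder : analyticOrderAt f b = 1 + analyticOrderAt (dslope f b) b := by
      conv_lhs => rw [funext hfactor]
      exact (analyticOrderAt_mul (by fun_prop) (hslope.analyticAt b)).trans
        (congrArg (· + _) analyticOrderAt_id_sub_const_self)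
    obtain ⟨q, hq, hqb, hfq⟩ := ih hslope <| by
      rw [hm, Nat.cast_succ, add_comm] at horder
      exact (ENat.add_right_injective_of_ne_top ENat.one_ne_top horder).symm
    exact ⟨q, hq, hqb, fun z => by rw [hfactor, hfq, pow_succ', mul_assoc]⟩

theorem exists_eq_mul_prod_sub_pow {f : ℂ → ℂ} (hf : Differentiable ℂ f) (S : Finset ℂ)
    (hS : ∀ a ∈ S, analyticOrderAt f a ≠ ⊤) :
    ∃ g : ℂ → ℂ, Differentiable ℂ g ∧ (∀ a ∈ S, g a ≠ 0) ∧
      ∀ z, f z = g z * ∏ a ∈ S, (z - a) ^ analyticOrderNatAt f a := by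
  induction S using Finset.induction_on with
  | empty => exact ⟨f, hf, by simp, by simp⟩
  | insert b S hb ih =>
    obtain ⟨g, hg, hgS, hfg⟩ := ih fun a ha => hS a (Finset.mem_insert_of_mem ha)
    set P : ℂ → ℂ := fun z => ∏ a ∈ S, (z - a) ^ analyticOrderNatAt f a
    have hP : AnalyticAt ℂ P b := by fun_prop
    have hPb : P b ≠ 0 := Finset.prod_ne_zero_iff.2 fun a ha =>
      pow_ne_zero _ (sub_ne_zero.2 (ne_of_mem_of_not_mem ha hb).symm)
    have horder : analyticOrderAt g b = analyticOrderNatAt f b := by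
      rw [Nat.cast_analyticOrderNatAt (hS b (Finset.mem_insert_self b S)),
        show f = g * P from funext hfg, analyticOrderAt_mul (hg.analyticAt b) hP,
        hP.analyticOrderAt_eq_zero.2 hPb, add_zero]
    obtain ⟨q, hq, hqb, hgq⟩ := exists_eq_pow_mul_of_analyticOrderAt_eq hg horder
    refine ⟨q, hq, Finset.forall_mem_insert _ _ _ |>.2 ⟨hqb, fun a ha hqa => hgS a ha ?_⟩,
      fun z => ?_⟩
    · rw [hgq, hqa, mul_zero]
    · rw [Finset.prod_insert hb, hfg, hgq]
      ring

theorem exists_eq_mul_prod_one_sub_div_pow {f : ℂ → ℂ} (hf : Differentiable ℂ f) (S : Finset ℂ)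
    (hS : ∀ a ∈ S, analyticOrderAt f a ≠ ⊤) (hS0 : 0 ∉ S) :
    ∃ g : ℂ → ℂ, Differentiable ℂ g ∧ (∀ a ∈ S, g a ≠ 0) ∧
      ∀ z, f z = g z * ∏ a ∈ S, (1 - z / a) ^ analyticOrderNatAt f a := by
  have hne : ∀ a ∈ S, a ≠ 0 := fun a ha => ne_of_mem_of_not_mem ha hS0
  obtain ⟨g, hg, hgS, hfg⟩ := exists_eq_mul_prod_sub_pow hf S hS
  set c : ℂ := ∏ a ∈ S, (-a) ^ analyticOrderNatAt f a
  have hc : c ≠ 0 := Finset.prod_ne_zero_iff.2 fun a ha => pow_ne_zero _ (neg_ne_zero.2 (hne a ha))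
  refine ⟨fun z => g z * c, hg.mul_const c, fun a ha => mul_ne_zero (hgS a ha) hc, fun z => ?_⟩
  rw [hfg, mul_assoc, ← Finset.prod_mul_distrib]
  congr 1
  refine Finset.prod_congr rfl fun a ha => ?_
  have ha0 := hne a ha
  rw [← mul_pow]
  field_simp
  ring

/-- The zeros of a function of one complex variable, each repeated according to its multiplicity:
a zero of order `m` contributes `m` indices. -/
abbrev ZeroIndex (f : ℂ → ℂ) : Type := Σ a : {a : ℂ // f a = 0}, Fin (analyticOrderNatAt f a)

theorem analyticOrderAt_ne_top_of_differentiable {f : ℂ → ℂ} (hf : Differentiable ℂ f) {b : ℂ}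
    (hb : f b ≠ 0) (a : ℂ) : analyticOrderAt f a ≠ ⊤ := by
  have hA : AnalyticOnNhd ℂ f Set.univ := fun z _ => hf.analyticAt z
  refine hA.analyticOrderAt_ne_top_of_isPreconnected isPreconnected_univ (Set.mem_univ b)
    (Set.mem_univ a) ?_
  simp [(hf.analyticAt b).analyticOrderAt_eq_zero.2 hb]

theorem finite_zeros_of_isCompact {f : ℂ → ℂ} (hf : Differentiable ℂ f) {b : ℂ} (hb : f b ≠ 0)
    {K : Set ℂ} (hK : IsCompact K) : {a ∈ K | f a = 0}.Finite := by
  have hA : AnalyticOnNhd ℂ f Set.univ := fun z _ => hf.analyticAt z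
  have hdiscrete : IsDiscrete (f ⁻¹' {0}) := by
    simpa using (mem_codiscrete'.1 (hA.preimage_zero_mem_codiscrete hb)).2
  exact (hK.inter_right (isClosed_singleton.preimage hf.continuous)).finite
    (hdiscrete.mono Set.inter_subset_right)

theorem exists_eq_mul_prod_zeroIndex {f : ℂ → ℂ} (hf : Differentiable ℂ f) (h0 : f 0 ≠ 0)
    {K : Set ℂ} (hK : IsCompact K) :
    ∃ (T : Finset (ZeroIndex f)) (g : ℂ → ℂ), (∀ i, i ∈ T ↔ (i.1 : ℂ) ∈ K) ∧
      Differentiable ℂ g ∧ (∀ z ∈ K, g z ≠ 0) ∧ ∀ z, f z = g z * ∏ i ∈ T, (1 - z / i.1) := by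
  classical
  set S : Finset ℂ := (finite_zeros_of_isCompact hf h0 hK).toFinset
  have hmem (a : ℂ) : a ∈ S ↔ a ∈ K ∧ f a = 0 := by simp [S]
  obtain ⟨g, hg, hgS, hfg⟩ := exists_eq_mul_prod_one_sub_div_pow hf S
    (fun a _ => analyticOrderAt_ne_top_of_differentiable hf h0 a) (fun h => h0 ((hmem 0).1 h).2)
  refine ⟨(S.subtype (f · = 0)).sigma fun _ => Finset.univ, g, fun i => by simp [hmem, i.1.2], hg,
    fun z hz hgz => hgS z ((hmem z).2 ⟨hz, by rw [hfg, hgz, zero_mul]⟩) hgz, fun z => ?_⟩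
  rw [hfg, Finset.prod_sigma]
  simp only [Finset.prod_const, Finset.card_univ, Fintype.card_fin]
  congr 1
  exact (Finset.prod_subtype_of_mem (fun a => (1 - z / a) ^ analyticOrderNatAt f a)
    fun a ha => ((hmem a).1 ha).2).symm

/-! ### Hadamard's theorem for order less than one -/

theorem exp_card_le_norm_prod_one_sub_div {ι : Type*} {a : ι → ℂ} {T : Finset ι} {R : ℝ}
    (ha0 : ∀ i ∈ T, a i ≠ 0) (haR : ∀ i ∈ T, ‖a i‖ ≤ R) {w : ℂ} (hw : 4 * R ≤ ‖w‖) :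
    Real.exp T.card ≤ ‖∏ i ∈ T, (1 - w / a i)‖ := by
  rw [norm_prod, ← Real.exp_one_pow, ← Finset.prod_const]
  refine Finset.prod_le_prod (fun _ _ => (Real.exp_pos 1).le) fun i hi => ?_
  have hdiv : 4 ≤ ‖w / a i‖ := by
    rw [norm_div, le_div_iff₀ (norm_pos_iff.2 (ha0 i hi))]
    linarith [haR i hi]
  have htriangle : ‖w / a i‖ - ‖(1 : ℂ)‖ ≤ ‖1 - w / a i‖ := by
    rw [norm_sub_rev]
    exact norm_sub_norm_le _ _
  rw [norm_one] at htriangle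
  linarith [Real.exp_one_lt_three]

theorem norm_mul_exp_card_le_of_sphere {ι : Type*} {a : ι → ℂ} {T : Finset ι} {g : ℂ → ℂ}
    (hg : Differentiable ℂ g) {R B : ℝ} (hR : 0 < R) (ha0 : ∀ i ∈ T, a i ≠ 0)
    (haR : ∀ i ∈ T, ‖a i‖ ≤ R)
    (hB : ∀ w, ‖w‖ = 4 * R → ‖g w * ∏ i ∈ T, (1 - w / a i)‖ ≤ B) {z : ℂ} (hz : ‖z‖ ≤ 4 * R) :
    ‖g z‖ * Real.exp T.card ≤ B := by
  rw [← le_div_iff₀ (Real.exp_pos _)]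
  refine Complex.norm_le_of_forall_mem_frontier_norm_le (U := ball (0 : ℂ) (4 * R))
    isBounded_ball hg.diffContOnCl (fun w hw => ?_) ?_
  · rw [frontier_ball (0 : ℂ) (by positivity), mem_sphere_zero_iff_norm] at hw
    rw [le_div_iff₀ (Real.exp_pos _)]
    refine le_trans ?_ (hB w hw)
    rw [norm_mul]
    gcongr
    exact exp_card_le_norm_prod_one_sub_div ha0 haR hw.ge
  · rwa [closure_ball (0 : ℂ) (by positivity), mem_closedBall_zero_iff]

theorem exists_eq_exp_of_ne_zero {g : ℂ → ℂ} {c : ℂ} {R : ℝ} (hg : DifferentiableOn ℂ g (ball c R))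
    (hne : ∀ z ∈ ball c R, g z ≠ 0) (hc : g c = 1) :
    ∃ G : ℂ → ℂ, DifferentiableOn ℂ G (ball c R) ∧ G c = 0 ∧
      ∀ z ∈ ball c R, g z = Complex.exp (G z) := by
  have hgd (x : ℂ) (hx : x ∈ ball c R) : HasDerivAt g (deriv g x) x :=
    (hg.differentiableAt (isOpen_ball.mem_nhds hx)).hasDerivAt
  obtain ⟨L, hL⟩ := ((hg.deriv isOpen_ball).div hg hne).isExactOn_ball
  set G : ℂ → ℂ := fun z => L z - L c
  have hG (x : ℂ) (hx : x ∈ ball c R) : HasDerivAt G (deriv g x / g x) x := (hL x hx).sub_const _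
  have hquot (x : ℂ) (hx : x ∈ ball c R) : HasDerivAt (fun y => g y * Complex.exp (-G y)) 0 x := by
    refine ((hgd x hx).mul (hG x hx).neg.cexp).congr_deriv ?_
    rw [mul_left_comm, mul_neg, mul_div_cancel₀ _ (hne x hx)]
    ring
  refine ⟨G, fun x hx => (hG x hx).differentiableAt.differentiableWithinAt, sub_self _,
    fun z hz => ?_⟩
  have hconst : g z * Complex.exp (-G z) = g c * Complex.exp (-G c) :=
    isOpen_ball.is_const_of_deriv_eq_zero (convex_ball c R).isPreconnected
      (fun y hy => (hquot y hy).differentiableAt.differentiableWithinAt)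
      (fun y hy => (hquot y hy).deriv) hz (mem_ball_self (pos_of_mem_ball hz))
  rw [hc, show G c = 0 from sub_self _, neg_zero, Complex.exp_zero, one_mul, Complex.exp_neg,
    mul_inv_eq_one₀ (Complex.exp_ne_zero _)] at hconst
  exact hconst

theorem exists_log_norm_le_of_norm_le_exp {g : ℂ → ℂ} {R M : ℝ}
    (hg : DifferentiableOn ℂ g (ball 0 R)) (hM : 0 < M) (hg0 : g 0 = 1)
    (hne : ∀ z ∈ ball (0 : ℂ) R, g z ≠ 0) (hle : ∀ z ∈ ball (0 : ℂ) R, ‖g z‖ ≤ Real.exp M) {z : ℂ}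
    (hz : z ∈ ball (0 : ℂ) R) :
    ∃ w : ℂ, g z = Complex.exp w ∧ ‖w‖ ≤ 2 * M * ‖z‖ / (R - ‖z‖) := by
  obtain ⟨G, hG, hG0, hgG⟩ := exists_eq_exp_of_ne_zero hg hne hg0
  refine ⟨G z, hgG z hz, Complex.borelCaratheodory_zero hM hG (fun x hx => ?_)
    (pos_of_mem_ball hz) hz hG0⟩
  rw [Set.mem_ofPred_eq, ← Real.exp_le_exp, ← Complex.norm_exp, ← hgG x hx]
  exact hle x hx

theorem sum_inv_le_sum_range_of_card_le {ι : Type*} {x : ι → ℝ} {C α : ℝ} (hα : 0 < α)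
    (hx : ∀ i, 1 ≤ x i)
    (hcard : ∀ R : ℝ, 1 ≤ R → ∀ U : Finset ι, (∀ i ∈ U, x i ≤ R) → (U.card : ℝ) ≤ C * R ^ α)
    (U : Finset ι) :
    ∑ i ∈ U, (x i)⁻¹ ≤ ∑ k ∈ Finset.range U.card, (C / ((k + 1 : ℕ) : ℝ)) ^ α⁻¹ := by
  classical
  induction U using Finset.induction_on_max_value x with
  | empty => simp
  | insert j U hj hmax ih =>
    have hxj : 0 < x j := one_pos.trans_le (hx j)
    have hcount : ((U.card + 1 : ℕ) : ℝ) ≤ C * x j ^ α := by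
      simpa [hj] using hcard (x j) (hx j) (insert j U) (by simpa using hmax)
    have hinv : (x j)⁻¹ ≤ (C / ((U.card + 1 : ℕ) : ℝ)) ^ α⁻¹ := by
      calc (x j)⁻¹ = ((x j ^ α)⁻¹) ^ α⁻¹ := by
            rw [← Real.inv_rpow hxj.le, Real.rpow_rpow_inv (by positivity) hα.ne']
        _ ≤ (C / ((U.card + 1 : ℕ) : ℝ)) ^ α⁻¹ := by
            gcongr
            rwa [le_div_iff₀ (by positivity), inv_mul_le_iff₀ (by positivity), mul_comm]
    rw [Finset.sum_insert hj, Finset.card_insert_of_notMem hj, Finset.sum_range_succ, add_comm]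
    gcongr

theorem summable_inv_of_card_le {ι : Type*} {x : ι → ℝ} {C α : ℝ} (hα0 : 0 < α) (hα1 : α < 1)
    (hcard : ∀ R : ℝ, 1 ≤ R → ∀ U : Finset ι, (∀ i ∈ U, x i ≤ R) → (U.card : ℝ) ≤ C * R ^ α) :
    Summable fun i => (x i)⁻¹ := by
  have hC : 0 ≤ C := by simpa using hcard 1 le_rfl ∅ (by simp)
  have hseries : Summable fun k : ℕ => (C / ((k + 1 : ℕ) : ℝ)) ^ α⁻¹ := by
    refine (summable_nat_add_iff (f := fun k : ℕ => (C / (k : ℝ)) ^ α⁻¹) 1).2 ?_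
    simp only [div_eq_mul_inv, Real.mul_rpow hC (inv_nonneg.2 (Nat.cast_nonneg _))]
    refine Summable.mul_left _ ?_
    simpa [Real.inv_rpow] using Real.summable_nat_rpow_inv.2 ((one_lt_inv₀ hα0).2 hα1)
  have hmax : Summable fun i => (max (x i) 1)⁻¹ := by
    refine summable_of_sum_le (fun i => inv_nonneg.2 (zero_le_one.trans (le_max_right _ _)))
      fun U => (sum_inv_le_sum_range_of_card_le hα0 (fun i => le_max_right _ _)
        (fun R hR U hU => hcard R hR U fun i hi => (le_max_left _ _).trans (hU i hi)) U).trans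
        (hseries.sum_le_tsum _ fun k _ => by positivity)
  have hfinite : {i | x i < 1}.Finite := by
    by_contra hinf
    obtain ⟨U, hU, hUcard⟩ := Set.Infinite.exists_subset_card_eq hinf (⌊C⌋₊ + 1)
    have hle := hcard 1 le_rfl U fun i hi => (hU hi).le
    rw [hUcard, Real.one_rpow, mul_one] at hle
    exact (Nat.lt_floor_add_one C).not_ge (by exact_mod_cast hle)
  refine (summable_congr_cofinite ?_).1 hmax
  filter_upwards [hfinite.compl_mem_cofinite] with i hi
  rw [max_eq_left (not_lt.1 (Set.notMem_ofPred_iff.1 hi))]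

theorem exists_eq_exp_mul_prod_zeroIndex {f : ℂ → ℂ} (hf : Differentiable ℂ f) (h0 : f 0 = 1)
    {C α : ℝ} (hC : 0 < C) (hgrowth : ∀ z, 1 ≤ ‖z‖ → ‖f z‖ ≤ Real.exp (C * ‖z‖ ^ α)) {R : ℝ}
    (hR : 1 ≤ R) :
    ∃ T : Finset (ZeroIndex f), (∀ i, i ∈ T ↔ ‖(i.1 : ℂ)‖ ≤ R) ∧ (T.card : ℝ) ≤ C * (4 * R) ^ α ∧
      ∀ z, ‖z‖ < R → ∃ w, f z = Complex.exp w * ∏ i ∈ T, (1 - z / i.1) ∧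
        ‖w‖ ≤ 2 * (C * (4 * R) ^ α) * ‖z‖ / (R - ‖z‖) := by
  have hR0 : 0 < R := one_pos.trans_le hR
  obtain ⟨T, g, hT, hg, hgne, hfg⟩ :=
    exists_eq_mul_prod_zeroIndex hf (h0 ▸ one_ne_zero) (isCompact_closedBall (0 : ℂ) R)
  simp only [mem_closedBall_zero_iff] at hT hgne
  have hg0 : g 0 = 1 := by simpa [h0] using (hfg 0).symm
  have hmax (z : ℂ) (hz : ‖z‖ ≤ 4 * R) :
      ‖g z‖ * Real.exp T.card ≤ Real.exp (C * (4 * R) ^ α) := by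
    refine norm_mul_exp_card_le_of_sphere (a := fun i => (i.1 : ℂ)) hg hR0 (fun i _ hi => ?_)
      (fun i hi => (hT i).1 hi) (fun w hw => ?_) hz
    · exact one_ne_zero (h0 ▸ hi ▸ i.1.2)
    · rw [← hfg, ← hw]
      exact hgrowth w (by linarith)
  refine ⟨T, hT, ?_, fun z hz => ?_⟩
  · simpa [hg0] using hmax 0 (by simpa using hR0.le)
  · obtain ⟨w, hgw, hw⟩ := exists_log_norm_le_of_norm_le_exp (M := C * (4 * R) ^ α)
      hg.differentiableOn (by positivity) hg0
      (fun x hx => hgne x (mem_ball_zero_iff.1 hx).le)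
      (fun x hx => le_trans (le_mul_of_one_le_right (norm_nonneg _)
        (Real.one_le_exp (Nat.cast_nonneg _))) (hmax x (by linarith [mem_ball_zero_iff.1 hx])))
      (mem_ball_zero_iff.2 hz)
    exact ⟨w, by rw [hfg, hgw], hw⟩

theorem summable_norm_inv_zeroIndex {f : ℂ → ℂ} (hf : Differentiable ℂ f) (h0 : f 0 = 1)
    {C α : ℝ} (hC : 0 < C) (hα0 : 0 < α) (hα1 : α < 1)
    (hgrowth : ∀ z, 1 ≤ ‖z‖ → ‖f z‖ ≤ Real.exp (C * ‖z‖ ^ α)) :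
    Summable fun i : ZeroIndex f => ‖(i.1 : ℂ)‖⁻¹ := by
  refine summable_inv_of_card_le (C := C * 4 ^ α) hα0 hα1 fun R hR U hU => ?_
  obtain ⟨T, hT, hcard, -⟩ := exists_eq_exp_mul_prod_zeroIndex hf h0 hC hgrowth hR
  have hUT : U ⊆ T := fun i hi => (hT i).2 (hU i hi)
  calc (U.card : ℝ) ≤ T.card := by exact_mod_cast Finset.card_le_card hUT
    _ ≤ C * (4 * R) ^ α := hcard
    _ = C * 4 ^ α * R ^ α := by rw [Real.mul_rpow (by norm_num) (by linarith), mul_assoc]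

theorem tendsto_mul_rpow_div_sub_atTop_zero {α : ℝ} (hα : α < 1) (c r : ℝ) :
    Tendsto (fun R : ℝ => c * R ^ α / (R - r)) atTop (𝓝 0) := by
  have hpow : Tendsto (fun R : ℝ => R ^ (α - 1)) atTop (𝓝 0) := by
    simpa using tendsto_rpow_neg_atTop (y := 1 - α) (by linarith)
  have hratio : Tendsto (fun R : ℝ => 1 - r / R) atTop (𝓝 1) := by
    simpa using (tendsto_const_nhds (x := r)).div_atTop tendsto_id |>.const_sub 1
  have hquot := (hpow.const_mul c).div hratio one_ne_zero
  rw [mul_zero, zero_div] at hquot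
  refine hquot.congr' ?_
  filter_upwards [eventually_gt_atTop 0] with R hR
  rw [Pi.div_apply, Real.rpow_sub_one hR.ne', one_sub_div hR.ne']
  field_simp

theorem hasProd_one_sub_div_zeroIndex {f : ℂ → ℂ} (hf : Differentiable ℂ f) (h0 : f 0 = 1)
    {C α : ℝ} (hC : 0 < C) (hα0 : 0 < α) (hα1 : α < 1)
    (hgrowth : ∀ z, 1 ≤ ‖z‖ → ‖f z‖ ≤ Real.exp (C * ‖z‖ ^ α)) (z : ℂ) :
    HasProd (fun i : ZeroIndex f => 1 - z / (i.1 : ℂ)) (f z) := by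
  have hmult : Multipliable fun i : ZeroIndex f => 1 - z / (i.1 : ℂ) := by
    simp only [sub_eq_add_neg]
    refine multipliable_one_add_of_summable ?_
    simpa [div_eq_mul_inv] using
      (summable_norm_inv_zeroIndex hf h0 hC hα0 hα1 hgrowth).mul_left ‖z‖
  choose! T hT _ w hw using fun (R : ℝ) (hR : 1 ≤ R) =>
    exists_eq_exp_mul_prod_zeroIndex hf h0 hC hgrowth hR
  have hTtop : Tendsto T atTop atTop := by
    refine tendsto_atTop.2 fun U => ?_
    filter_upwards [eventually_ge_atTop 1,
      (Filter.eventually_all_finset U).2 fun i _ => eventually_ge_atTop ‖(i.1 : ℂ)‖] with R h1 hR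
    exact fun i hi => (hT R h1 i).2 (hR i hi)
  have hw0 : Tendsto (w · z) atTop (𝓝 0) := by
    refine squeeze_zero_norm' ?_
      (tendsto_mul_rpow_div_sub_atTop_zero hα1 (2 * C * 4 ^ α * ‖z‖) ‖z‖)
    filter_upwards [eventually_ge_atTop 1, eventually_gt_atTop ‖z‖] with R h1 hR
    refine (hw R h1 z hR).2.trans_eq ?_
    rw [Real.mul_rpow (by norm_num) (by linarith)]
    ring
  have hlim := ((Complex.continuous_exp.tendsto 0).comp hw0).mul (hmult.hasProd.comp hTtop)
  rw [Complex.exp_zero, one_mul] at hlim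
  have heq : f z = ∏' i : ZeroIndex f, (1 - z / (i.1 : ℂ)) := by
    refine tendsto_nhds_unique (tendsto_const_nhds.congr' ?_) hlim
    filter_upwards [eventually_ge_atTop 1, eventually_gt_atTop ‖z‖] with R h1 hR
    exact (hw R h1 z hR).1
  exact heq ▸ hmult.hasProd

/-! ### Growth of the completed zeta function -/

section Mellin

open MeasureTheory Set ComplexOrder

theorem norm_mellin_ofReal_of_nonneg {F : ℝ → ℂ} (hF : ∀ t, 0 < t → 0 ≤ F t) (a : ℝ) :
    ‖mellin F a‖ = ∫ t in Ioi (0 : ℝ), ‖(t : ℂ) ^ ((a : ℂ) - 1) • F t‖ := by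
  have hnonneg (t : ℝ) (ht : t ∈ Ioi (0 : ℝ)) :
      (t : ℂ) ^ ((a : ℂ) - 1) • F t = ‖(t : ℂ) ^ ((a : ℂ) - 1) • F t‖ := by
    rw [norm_smul, Complex.ofReal_mul, ← Complex.eq_coe_norm_of_nonneg (hF t ht), smul_eq_mul,
      ← Complex.ofReal_one, ← Complex.ofReal_sub, ← Complex.ofReal_cpow (mem_Ioi.1 ht).le,
      Complex.norm_of_nonneg (Real.rpow_nonneg (mem_Ioi.1 ht).le _)]
  rw [mellin, setIntegral_congr_fun measurableSet_Ioi hnonneg, integral_complex_ofReal,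
    Complex.norm_of_nonneg (integral_nonneg fun _ => norm_nonneg _)]

theorem norm_mellin_le_add {F : ℝ → ℂ} (hF : ∀ t, 0 < t → 0 ≤ F t) {a b : ℝ} {s : ℂ}
    (ha : a ≤ s.re) (hb : s.re ≤ b) (hFa : MellinConvergent F a) (hFb : MellinConvergent F b) :
    ‖mellin F s‖ ≤ ‖mellin F a‖ + ‖mellin F b‖ := by
  rw [norm_mellin_ofReal_of_nonneg hF, norm_mellin_ofReal_of_nonneg hF,
    ← integral_add hFa.norm hFb.norm]
  refine norm_integral_le_of_norm_le (hFa.norm.add hFb.norm) ?_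
  filter_upwards [ae_restrict_mem measurableSet_Ioi] with t ht
  have ht : 0 < t := ht
  simp only [norm_smul, Complex.norm_cpow_eq_rpow_re_of_pos ht, Complex.sub_re, Complex.one_re,
    Complex.ofReal_re, ← add_mul]
  gcongr
  have hpa : 0 ≤ t ^ (a - 1) := by positivity
  have hpb : 0 ≤ t ^ (b - 1) := by positivity
  rcases le_total 1 t with h1 | h1
  · linarith [Real.rpow_le_rpow_of_exponent_le h1 (sub_le_sub_right hb 1)]
  · linarith [Real.rpow_le_rpow_of_exponent_ge ht h1 (sub_le_sub_right ha 1)]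

end Mellin

theorem one_le_evenKernel_zero {t : ℝ} (ht : 0 < t) : 1 ≤ HurwitzZeta.evenKernel 0 t := by
  have h := (HurwitzZeta.hasSum_int_evenKernel₀ 0 ht).nonneg fun n => by split_ifs <;> positivity
  simpa using h

theorem rpow_neg_half_le_evenKernel_zero {t : ℝ} (ht : 0 < t) :
    t ^ (-(1 / 2) : ℝ) ≤ HurwitzZeta.evenKernel 0 t := by
  rw [HurwitzZeta.evenKernel_functional_equation, ← HurwitzZeta.evenKernel_eq_cosKernel_of_zero,
    Real.rpow_neg ht.le, ← one_div]
  exact le_mul_of_one_le_right (by positivity) (one_le_evenKernel_zero (one_div_pos.2 ht))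

open ComplexOrder in
theorem f_modif_hurwitzEvenFEPair_zero_nonneg (t : ℝ) :
    0 ≤ (HurwitzZeta.hurwitzEvenFEPair 0).f_modif t := by
  refine add_nonneg (Set.indicator_apply_nonneg fun ht => ?_)
    (Set.indicator_apply_nonneg fun ht => ?_)
  · have h := one_le_evenKernel_zero (one_pos.trans ht)
    simpa [HurwitzZeta.hurwitzEvenFEPair] using mod_cast h
  · have h := rpow_neg_half_le_evenKernel_zero ht.1
    rw [one_div] at h
    simpa [HurwitzZeta.hurwitzEvenFEPair] using mod_cast h

theorem norm_completedRiemannZeta₀_le_add {a b : ℝ} {s : ℂ} (ha : a ≤ s.re) (hb : s.re ≤ b) :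
    ‖completedRiemannZeta₀ s‖ ≤ ‖completedRiemannZeta₀ a‖ + ‖completedRiemannZeta₀ b‖ := by
  have hΛ (z : ℂ) : ‖completedRiemannZeta₀ z‖ =
      ‖mellin (HurwitzZeta.hurwitzEvenFEPair 0).f_modif (z / 2)‖ / 2 := by
    rw [← Complex.norm_two, ← norm_div]
    rfl
  have hconv (z : ℂ) : MellinConvergent (HurwitzZeta.hurwitzEvenFEPair 0).f_modif z :=
    ((HurwitzZeta.hurwitzEvenFEPair 0).isStrongFEPair_toStrongFEPair.hasMellin z).1
  have h := norm_mellin_le_add (fun t _ => f_modif_hurwitzEvenFEPair_zero_nonneg t) (s := s / 2)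
    (a := a / 2) (b := b / 2) (by simpa using by linarith) (by simpa using by linarith)
    (hconv _) (hconv _)
  push_cast at h
  rw [hΛ, hΛ, hΛ]
  linarith

theorem norm_completedRiemannZeta₀_one_lt_two : ‖completedRiemannZeta₀ 1‖ < 2 := by
  have hval : completedRiemannZeta₀ 1 =
      (((Real.eulerMascheroniConstant - Real.log (4 * Real.pi)) / 2 + 1 : ℝ) : ℂ) := by
    rw [completedRiemannZeta₀_one]
    push_cast [Complex.ofReal_log (by positivity : (0 : ℝ) ≤ 4 * Real.pi)]
    rfl
  have hlog_nonneg : 0 ≤ Real.log (4 * Real.pi) := Real.log_nonneg (by linarith [Real.pi_gt_three])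
  have hlog_le : Real.log (4 * Real.pi) ≤ 6 := by
    calc Real.log (4 * Real.pi) ≤ Real.log (2 ^ 4) :=
          Real.log_le_log (by positivity) (by linarith [Real.pi_lt_four])
      _ = 4 * Real.log 2 := by rw [Real.log_pow]; norm_num
      _ ≤ 6 := by linarith [Real.log_two_lt_d9]
  rw [hval, Complex.norm_real, Real.norm_eq_abs, abs_lt]
  constructor <;>
    linarith [Real.eulerMascheroniConstant_lt_two_thirds, Real.one_half_lt_eulerMascheroniConstant]

theorem norm_completedRiemannZeta₀_lt_four {s : ℂ} (h0 : 0 ≤ s.re) (h1 : s.re ≤ 1) :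
    ‖completedRiemannZeta₀ s‖ < 4 := by
  have hsymm : completedRiemannZeta₀ 0 = completedRiemannZeta₀ 1 := by
    simpa using completedRiemannZeta₀_one_sub 1
  have hedges := norm_completedRiemannZeta₀_le_add h0 h1
  rw [Complex.ofReal_zero, Complex.ofReal_one, hsymm] at hedges
  linarith [norm_completedRiemannZeta₀_one_lt_two]

theorem norm_riemannZeta_natCast_le {n : ℕ} (hn : 2 ≤ n) : ‖riemannZeta n‖ ≤ Real.pi ^ 2 / 6 := by
  rw [zeta_nat_eq_tsum_of_gt_one hn]
  refine tsum_of_norm_bounded hasSum_zeta_two fun k => ?_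
  rw [norm_div, norm_one, norm_pow, Complex.norm_natCast]
  rcases k.eq_zero_or_pos with rfl | hk
  · simp [show n ≠ 0 by lia]
  · have hk1 : (1 : ℝ) ≤ k := mod_cast hk
    gcongr

theorem norm_Gammaℝ_two_mul_le_factorial {k : ℕ} (hk : k ≠ 0) :
    ‖Complex.Gammaℝ (2 * k)‖ ≤ k.factorial := by
  obtain ⟨m, rfl⟩ := Nat.exists_eq_succ_of_ne_zero hk
  have hpi : Real.pi ^ (-(2 * ((m + 1 : ℕ) : ℂ)) / 2).re ≤ 1 := by
    refine Real.rpow_le_one_of_one_le_of_nonpos (by linarith [Real.pi_gt_three]) ?_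
    rw [neg_div, mul_div_cancel_left₀ _ two_ne_zero, Complex.neg_re, Complex.natCast_re]
    exact neg_nonpos.2 (Nat.cast_nonneg _)
  rw [Complex.Gammaℝ_def, norm_mul, Complex.norm_cpow_eq_rpow_re_of_pos Real.pi_pos,
    mul_div_cancel_left₀ _ two_ne_zero, Nat.cast_succ, Complex.Gamma_nat_eq_factorial,
    Complex.norm_natCast, ← Nat.cast_succ]
  calc _ ≤ 1 * (m.factorial : ℝ) := by gcongr
    _ ≤ (m + 1).factorial := by
      rw [one_mul]
      exact_mod_cast Nat.factorial_le m.le_succ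

theorem norm_completedRiemannZeta₀_two_mul_le {k : ℕ} (hk : k ≠ 0) :
    ‖completedRiemannZeta₀ (2 * k)‖ ≤ 6 * k.factorial := by
  have hk1 : (1 : ℝ) ≤ k := mod_cast Nat.one_le_iff_ne_zero.2 hk
  have h0 : 2 * (k : ℂ) ≠ 0 := by simpa using hk
  have hΓ : Complex.Gammaℝ (2 * k) ≠ 0 :=
    Complex.Gammaℝ_ne_zero_of_re_pos (by simpa using hk.bot_lt)
  have hsum : completedRiemannZeta₀ (2 * k) =
      riemannZeta (2 * k) * Complex.Gammaℝ (2 * k) + 1 / (2 * k) + 1 / (1 - 2 * k) := by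
    rw [riemannZeta_def_of_ne_zero h0, div_mul_cancel₀ _ hΓ, completedRiemannZeta_eq]
    ring
  have hζ : ‖riemannZeta (2 * k)‖ ≤ 4 := by
    have hζ' := norm_riemannZeta_natCast_le (n := 2 * k) (by lia)
    push_cast at hζ'
    nlinarith [Real.pi_lt_four, Real.pi_pos]
  have hpole0 : ‖(1 : ℂ) / (2 * k)‖ ≤ 1 := by
    rw [norm_div, norm_one, norm_mul, Complex.norm_two, Complex.norm_natCast]
    exact div_le_one_of_le₀ (by linarith) (by positivity)
  have hpole1 : ‖(1 : ℂ) / (1 - 2 * k)‖ ≤ 1 := by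
    rw [norm_div, norm_one, norm_sub_rev]
    have htriangle := norm_sub_norm_le (2 * (k : ℂ)) 1
    rw [norm_mul, Complex.norm_two, Complex.norm_natCast, norm_one] at htriangle
    exact div_le_one_of_le₀ (by linarith) (norm_nonneg _)
  have hfactorial : (1 : ℝ) ≤ k.factorial := mod_cast k.factorial_pos
  calc _ ≤ ‖riemannZeta (2 * k)‖ * ‖Complex.Gammaℝ (2 * k)‖ + ‖(1 : ℂ) / (2 * k)‖ +
        ‖(1 : ℂ) / (1 - 2 * k)‖ := by rw [hsum, ← norm_mul]; exact norm_add₃_le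
    _ ≤ 4 * k.factorial + 1 + 1 := by gcongr; exact norm_Gammaℝ_two_mul_le_factorial hk
    _ ≤ _ := by linarith

theorem norm_completedRiemannZeta₀_le_factorial {k : ℕ} {s : ℂ} (hk : k ≠ 0)
    (hs : ‖s‖ ≤ 2 * k - 1) : ‖completedRiemannZeta₀ s‖ ≤ 12 * k.factorial := by
  have hre := abs_le.1 (Complex.abs_re_le_norm s)
  have hedges := norm_completedRiemannZeta₀_le_add (a := 1 - 2 * k) (b := 2 * k) (s := s)
    (by linarith [hre.1]) (by linarith [hre.2])
  push_cast at hedges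
  rw [completedRiemannZeta₀_one_sub] at hedges
  linarith [norm_completedRiemannZeta₀_two_mul_le hk]

theorem factorial_le_exp_rpow (k : ℕ) :
    (k.factorial : ℝ) ≤ Real.exp (2 * (k : ℝ) ^ (3 / 2 : ℝ)) := by
  rcases k.eq_zero_or_pos with rfl | hk
  · simp
  have hk0 : (0 : ℝ) < k := mod_cast hk
  calc (k.factorial : ℝ) ≤ (k : ℝ) ^ k := mod_cast k.factorial_le_pow
    _ = Real.exp (k * Real.log k) := by rw [Real.exp_nat_mul, Real.exp_log hk0]
    _ ≤ Real.exp (k * ((k : ℝ) ^ (1 / 2 : ℝ) / (1 / 2))) := by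
        gcongr
        exact Real.log_le_rpow_div hk0.le one_half_pos
    _ = Real.exp (2 * (k : ℝ) ^ (3 / 2 : ℝ)) := by
        rw [show (3 / 2 : ℝ) = 1 + 1 / 2 by norm_num, Real.rpow_one_add' hk0.le (by norm_num)]
        ring_nf

theorem two_mul_rpow_three_halves_le {x : ℝ} (hx : 0 ≤ x) :
    (2 * x) ^ (3 / 2 : ℝ) ≤ 4 * x ^ (3 / 2 : ℝ) := by
  rw [Real.mul_rpow zero_le_two hx]
  gcongr
  calc (2 : ℝ) ^ (3 / 2 : ℝ) ≤ 2 ^ (2 : ℝ) :=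
        Real.rpow_le_rpow_of_exponent_le one_le_two (by norm_num)
    _ = 4 := by norm_num

theorem norm_completedRiemannZeta₀_le_exp {A : ℝ} (hA : 1 ≤ A) {s : ℂ} (hs : ‖s‖ ≤ A) :
    ‖completedRiemannZeta₀ s‖ ≤ Real.exp (18 * A ^ (3 / 2 : ℝ)) := by
  obtain ⟨k, hk, hAk, hkA⟩ : ∃ k : ℕ, k ≠ 0 ∧ A ≤ k ∧ k ≤ 2 * A :=
    ⟨⌈A⌉₊, (Nat.ceil_pos.2 (by linarith)).ne', Nat.le_ceil A,
      by linarith [Nat.ceil_lt_add_one (zero_le_one.trans hA)]⟩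
  have hpow : (k : ℝ) ^ (3 / 2 : ℝ) ≤ 4 * A ^ (3 / 2 : ℝ) := by
    refine le_trans ?_ (two_mul_rpow_three_halves_le (zero_le_one.trans hA))
    gcongr
  have hA32 : 1 ≤ A ^ (3 / 2 : ℝ) := Real.one_le_rpow hA (by norm_num)
  have htwelve : 12 ≤ Real.exp (10 * A ^ (3 / 2 : ℝ)) := by
    nlinarith [Real.quadratic_le_exp_of_nonneg (show 0 ≤ 10 * A ^ (3 / 2 : ℝ) by positivity)]
  calc _ ≤ 12 * (k.factorial : ℝ) :=
        norm_completedRiemannZeta₀_le_factorial hk (by linarith)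
    _ ≤ Real.exp (10 * A ^ (3 / 2 : ℝ)) * Real.exp (2 * (k : ℝ) ^ (3 / 2 : ℝ)) := by
        gcongr
        exact factorial_le_exp_rpow k
    _ = Real.exp (10 * A ^ (3 / 2 : ℝ) + 2 * (k : ℝ) ^ (3 / 2 : ℝ)) := (Real.exp_add _ _).symm
    _ ≤ _ := by gcongr; linarith

/-! ### Functions of `s * (1 - s)` -/

theorem exists_differentiable_comp_sq_of_even {F : ℂ → ℂ} (hF : Differentiable ℂ F)
    (heven : ∀ w, F (-w) = F w) : ∃ H : ℂ → ℂ, Differentiable ℂ H ∧ ∀ w, F w = H (w ^ 2) := by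
  have hsq {w v : ℂ} (h : w ^ 2 = v ^ 2) : F w = F v := by
    rcases sq_eq_sq_iff_eq_or_eq_neg.1 h with rfl | rfl
    exacts [rfl, heven v]
  have hroot (z : ℂ) : (z ^ (2⁻¹ : ℂ)) ^ 2 = z := by simp
  set H : ℂ → ℂ := fun z => F (z ^ (2⁻¹ : ℂ))
  -- Rotating by a square root of `z₀` moves the branch cut of the square root away from `z₀`.
  have hdiff (z₀ : ℂ) (hz₀ : z₀ ≠ 0) : DifferentiableAt ℂ H z₀ := by
    have hrotate : H = fun z => F (z₀ ^ (2⁻¹ : ℂ) * (z / z₀) ^ (2⁻¹ : ℂ)) :=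
      funext fun z => hsq <| by rw [mul_pow, hroot, hroot, hroot, mul_div_cancel₀ _ hz₀]
    have hslit : z₀ / z₀ ∈ Complex.slitPlane := by simp [hz₀]
    rw [hrotate]
    exact (hF _).comp z₀ (((differentiableAt_id.div_const z₀).cpow_const hslit).const_mul _)
  have hcont : ContinuousAt H 0 := hF.continuous.continuousAt.comp <|
    (Complex.continuousAt_cpow_zero_of_re_pos (by norm_num)).comp
      (f := fun z : ℂ => (z, (2⁻¹ : ℂ))) (by fun_prop)
  refine ⟨H, fun z => ?_, fun w => hsq (hroot _).symm⟩
  rcases eq_or_ne z 0 with rfl | hz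
  · refine (Complex.analyticAt_of_differentiable_on_punctured_nhds_of_continuousAt ?_
      hcont).differentiableAt
    filter_upwards [self_mem_nhdsWithin] with z hz using hdiff z hz
  · exact hdiff z hz

theorem exists_differentiable_comp_mul_one_sub {F : ℂ → ℂ} (hF : Differentiable ℂ F)
    (hsymm : ∀ s, F (1 - s) = F s) :
    ∃ h : ℂ → ℂ, Differentiable ℂ h ∧ ∀ s, F s = h (s * (1 - s)) := by
  obtain ⟨H, hH, hFH⟩ := exists_differentiable_comp_sq_of_even (F := fun w => F (1 / 2 + w))
    (hF.comp (by fun_prop)) fun w => by rw [← hsymm]; ring_nf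
  refine ⟨fun z => H (1 / 4 - z), hH.comp (by fun_prop), fun s => ?_⟩
  have h := hFH (s - 1 / 2)
  ring_nf at h ⊢
  exact h

theorem exists_mul_one_sub_eq (z : ℂ) : ∃ s : ℂ, s * (1 - s) = z := by
  obtain ⟨w, hw⟩ := IsAlgClosed.exists_pow_nat_eq (1 / 4 - z) two_pos
  exact ⟨1 / 2 + w, by linear_combination -hw⟩

theorem mul_one_sub_injOn_upperHalfPlane : Set.InjOn (fun s : ℂ => s * (1 - s)) {s | 0 < s.im} := by
  intro s hs t ht (hst : s * (1 - s) = t * (1 - t))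
  have hprod : (s - t) * (1 - s - t) = 0 := by linear_combination hst
  refine sub_eq_zero.1 ((mul_eq_zero.1 hprod).resolve_right fun h => ?_)
  have him : 0 - s.im - t.im = 0 := congrArg Complex.im h
  linarith [show 0 < s.im from hs, show 0 < t.im from ht]

theorem analyticOrderAt_comp_mul_one_sub {h : ℂ → ℂ} {s : ℂ} (hs : s ≠ 1 / 2) :
    analyticOrderAt (fun s => h (s * (1 - s))) s = analyticOrderAt h (s * (1 - s)) := by
  have hderiv : HasDerivAt (fun s : ℂ => s * (1 - s)) (1 - 2 * s) s :=
    ((hasDerivAt_id s).mul ((hasDerivAt_id s).const_sub 1)).congr_deriv (by simp only [id]; ring)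
  refine analyticOrderAt_comp_of_deriv_ne_zero (f := h) (by fun_prop) ?_
  rw [hderiv.deriv]
  exact fun h0 => hs (by linear_combination -h0 / 2)

/-! ### The xi function and its zeros -/

/-- The Riemann xi function, normalised to have the value `1` at `0`. In terms of the completed zeta
function `Λ` it is `s * (s - 1) * Λ s`; writing it through the entire function `Λ₀` gives the right
values at the poles `0` and `1` of `Λ`. -/
noncomputable def normalizedXi (s : ℂ) : ℂ := 1 - s * (1 - s) * completedRiemannZeta₀ s

theorem differentiable_normalizedXi : Differentiable ℂ normalizedXi := by
  have := differentiable_completedZeta₀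
  unfold normalizedXi
  fun_prop

theorem normalizedXi_one_sub (s : ℂ) : normalizedXi (1 - s) = normalizedXi s := by
  rw [normalizedXi, normalizedXi, completedRiemannZeta₀_one_sub, sub_sub_cancel, mul_comm s]

theorem normalizedXi_eq_mul_completedRiemannZeta {s : ℂ} (h0 : s ≠ 0) (h1 : s ≠ 1) :
    normalizedXi s = s * (s - 1) * completedRiemannZeta s := by
  have h1' : 1 - s ≠ 0 := sub_ne_zero.2 h1.symm
  rw [normalizedXi, completedRiemannZeta_eq]
  field_simp
  ring

theorem riemannZeta_eq_mul_normalizedXi {s : ℂ} (h0 : s ≠ 0) (h1 : s ≠ 1) :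
    riemannZeta s = (s * (s - 1))⁻¹ * (Complex.Gammaℝ s)⁻¹ * normalizedXi s := by
  have h1' : s - 1 ≠ 0 := sub_ne_zero.2 h1
  rw [normalizedXi_eq_mul_completedRiemannZeta h0 h1, riemannZeta_def_of_ne_zero h0]
  field_simp

theorem Gamma_one_add_half_ne_zero {s : ℂ} (hs : ∀ n : ℕ, s ≠ -2 * (n + 1)) :
    Complex.Gamma (1 + s / 2) ≠ 0 :=
  Complex.Gamma_ne_zero fun n hn => hs n (by linear_combination 2 * hn)

theorem cpow_mul_normalizedXi {s : ℂ} (h1 : s ≠ 1) (hs : ∀ n : ℕ, s ≠ -2 * (n + 1)) :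
    (Real.pi : ℂ) ^ (s / 2) * normalizedXi s =
      2 * (s - 1) * Complex.Gamma (1 + s / 2) * riemannZeta s := by
  have hΓ := Gamma_one_add_half_ne_zero hs
  rcases eq_or_ne s 0 with rfl | h0
  · norm_num [normalizedXi, riemannZeta_zero]
  have hs2 : s / 2 ≠ 0 := div_ne_zero h0 two_ne_zero
  have hπ : (Real.pi : ℂ) ^ (s / 2) ≠ 0 := by simp [Complex.cpow_eq_zero_iff, Real.pi_ne_zero]
  rw [add_comm, Complex.Gamma_add_one _ hs2] at hΓ ⊢
  rw [normalizedXi_eq_mul_completedRiemannZeta h0 h1, riemannZeta_def_of_ne_zero h0,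
    Complex.Gammaℝ_def, neg_div, Complex.cpow_neg]
  have hΓ2 := right_ne_zero_of_mul hΓ
  field_simp

theorem Gammaℝ_ne_zero_of_im_ne_zero {s : ℂ} (hs : s.im ≠ 0) : Complex.Gammaℝ s ≠ 0 := by
  rw [Ne, Complex.Gammaℝ_eq_zero_iff]
  rintro ⟨n, rfl⟩
  simp at hs

theorem normalizedXi_eq_zero_iff_of_im_ne_zero {s : ℂ} (hs : s.im ≠ 0) :
    normalizedXi s = 0 ↔ riemannZeta s = 0 := by
  have h0 : s ≠ 0 := ne_of_apply_ne Complex.im hs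
  have h1 : s ≠ 1 := ne_of_apply_ne Complex.im hs
  simp [riemannZeta_eq_mul_normalizedXi h0 h1, h0, sub_ne_zero.2 h1,
    Gammaℝ_ne_zero_of_im_ne_zero hs]

theorem analyticOrderAt_riemannZeta_eq {ρ : ℂ} (hρ : ρ.im ≠ 0) :
    analyticOrderAt riemannZeta ρ = analyticOrderAt normalizedXi ρ := by
  have h0 : ρ ≠ 0 := ne_of_apply_ne Complex.im hρ
  have h1 : ρ ≠ 1 := ne_of_apply_ne Complex.im hρ
  set c : ℂ → ℂ := fun s => (s * (s - 1))⁻¹ * (Complex.Gammaℝ s)⁻¹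
  have hne : ρ * (ρ - 1) ≠ 0 := mul_ne_zero h0 (sub_ne_zero.2 h1)
  have hc : AnalyticAt ℂ c ρ :=
    AnalyticAt.mul (AnalyticAt.inv (by fun_prop) hne)
      (Complex.differentiable_Gammaℝ_inv.analyticAt ρ)
  have hcρ : c ρ ≠ 0 :=
    mul_ne_zero (inv_ne_zero hne) (inv_ne_zero (Gammaℝ_ne_zero_of_im_ne_zero hρ))
  have heq : riemannZeta =ᶠ[𝓝 ρ] c * normalizedXi := by
    filter_upwards [eventually_ne_nhds h0, eventually_ne_nhds h1] with s hs0 hs1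
    exact riemannZeta_eq_mul_normalizedXi hs0 hs1
  rw [analyticOrderAt_congr heq, analyticOrderAt_mul hc (differentiable_normalizedXi.analyticAt ρ),
    hc.analyticOrderAt_eq_zero.2 hcρ, zero_add]

theorem normalizedXi_ne_zero_of_one_lt_re {s : ℂ} (hs : 1 < s.re) : normalizedXi s ≠ 0 := by
  have h0 : s ≠ 0 := by rintro rfl; norm_num at hs
  have h1 : s ≠ 1 := by rintro rfl; norm_num at hs
  intro h
  refine riemannZeta_ne_zero_of_one_lt_re hs ?_
  rw [riemannZeta_eq_mul_normalizedXi h0 h1, h, mul_zero]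

theorem normalizedXi_ofReal_ne_zero_of_mem_Icc {x : ℝ} (hx : x ∈ Set.Icc (0 : ℝ) 1) :
    normalizedXi x ≠ 0 := by
  intro h
  have hx0 : 0 ≤ x * (1 - x) := mul_nonneg hx.1 (sub_nonneg.2 hx.2)
  have hnorm : x * (1 - x) * ‖completedRiemannZeta₀ x‖ = 1 := by
    have hprod : ((x * (1 - x) : ℝ) : ℂ) * completedRiemannZeta₀ x = 1 := by
      push_cast
      exact (sub_eq_zero.1 h).symm
    simpa only [norm_mul, Complex.norm_real, Real.norm_of_nonneg hx0, norm_one] using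
      congrArg norm hprod
  have hlt : ‖completedRiemannZeta₀ x‖ < 4 :=
    norm_completedRiemannZeta₀_lt_four (by simpa using hx.1) (by simpa using hx.2)
  nlinarith [sq_nonneg (2 * x - 1), norm_nonneg (completedRiemannZeta₀ x)]

theorem normalizedXi_ofReal_ne_zero (x : ℝ) : normalizedXi x ≠ 0 := by
  rcases lt_or_ge 1 x with h1 | h1
  · exact normalizedXi_ne_zero_of_one_lt_re (by simpa using h1)
  rcases lt_or_ge x 0 with h0 | h0
  · rw [← normalizedXi_one_sub]
    exact normalizedXi_ne_zero_of_one_lt_re (by simpa [sub_eq_add_neg] using h0)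
  · exact normalizedXi_ofReal_ne_zero_of_mem_Icc ⟨h0, h1⟩

theorem im_ne_zero_of_normalizedXi_eq_zero {s : ℂ} (hs : normalizedXi s = 0) : s.im ≠ 0 := by
  intro him
  rw [show s = (s.re : ℂ) from Complex.ext rfl him] at hs
  exact normalizedXi_ofReal_ne_zero _ hs

theorem norm_le_two_mul_sqrt_norm_mul_one_sub {s : ℂ} (hs : 1 ≤ ‖s * (1 - s)‖) :
    ‖s‖ ≤ 2 * √‖s * (1 - s)‖ := by
  have hsqrt : 1 ≤ √‖s * (1 - s)‖ := Real.one_le_sqrt.2 hs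
  have hmul : ‖s‖ * ‖1 - s‖ = √‖s * (1 - s)‖ ^ 2 := by
    rw [Real.sq_sqrt (norm_nonneg _), norm_mul]
  have htriangle : ‖s‖ - 1 ≤ ‖1 - s‖ := by
    rw [norm_sub_rev, ← norm_one (α := ℂ)]
    exact norm_sub_norm_le s 1
  nlinarith [norm_nonneg s, norm_nonneg (1 - s)]

theorem one_add_le_exp_two_mul_rpow {x : ℝ} (hx : 1 ≤ x) :
    1 + x ≤ Real.exp (2 * x ^ (3 / 4 : ℝ)) := by
  have hx0 : 0 ≤ x := zero_le_one.trans hx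
  have hsq : x ≤ (x ^ (3 / 4 : ℝ)) ^ 2 := by
    rw [← Real.rpow_mul_natCast hx0]
    exact Real.self_le_rpow_of_one_le hx (by norm_num)
  have hpow : 0 ≤ x ^ (3 / 4 : ℝ) := by positivity
  nlinarith [Real.quadratic_le_exp_of_nonneg (mul_nonneg zero_le_two hpow)]

theorem norm_normalizedXi_le {s : ℂ} (hs : 1 ≤ ‖s * (1 - s)‖) :
    ‖normalizedXi s‖ ≤ Real.exp (74 * ‖s * (1 - s)‖ ^ (3 / 4 : ℝ)) := by
  set R : ℝ := ‖s * (1 - s)‖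
  have hpow : (2 * √R) ^ (3 / 2 : ℝ) ≤ 4 * R ^ (3 / 4 : ℝ) := by
    refine (two_mul_rpow_three_halves_le (Real.sqrt_nonneg R)).trans_eq ?_
    rw [Real.sqrt_eq_rpow, ← Real.rpow_mul (norm_nonneg _),
      show (1 / 2 * (3 / 2) : ℝ) = 3 / 4 by norm_num]
  have hΛ : ‖completedRiemannZeta₀ s‖ ≤ Real.exp (72 * R ^ (3 / 4 : ℝ)) := by
    refine (norm_completedRiemannZeta₀_le_exp (A := 2 * √R) ?_
      (norm_le_two_mul_sqrt_norm_mul_one_sub hs)).trans (Real.exp_le_exp.2 (by linarith))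
    linarith [Real.one_le_sqrt.2 hs]
  calc ‖normalizedXi s‖ ≤ ‖(1 : ℂ)‖ + ‖s * (1 - s) * completedRiemannZeta₀ s‖ := norm_sub_le _ _
    _ ≤ 1 + R * Real.exp (72 * R ^ (3 / 4 : ℝ)) := by
        rw [norm_one, norm_mul]
        gcongr
    _ ≤ (1 + R) * Real.exp (72 * R ^ (3 / 4 : ℝ)) := by
        rw [one_add_mul]
        gcongr
        exact Real.one_le_exp (by positivity)
    _ ≤ Real.exp (2 * R ^ (3 / 4 : ℝ)) * Real.exp (72 * R ^ (3 / 4 : ℝ)) := by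
        gcongr
        exact one_add_le_exp_two_mul_rpow hs
    _ = Real.exp (74 * R ^ (3 / 4 : ℝ)) := by rw [← Real.exp_add]; ring_nf

theorem bijOn_mul_one_sub_upperZetaZeros {h : ℂ → ℂ}
    (hxi : ∀ s, normalizedXi s = h (s * (1 - s))) :
    Set.BijOn (fun s => s * (1 - s)) upperZetaZeros {a | h a = 0} := by
  refine ⟨fun ρ hρ => ?_, mul_one_sub_injOn_upperHalfPlane.mono fun ρ hρ => hρ.2, fun a ha => ?_⟩
  · change h (ρ * (1 - ρ)) = 0
    rw [← hxi]
    exact (normalizedXi_eq_zero_iff_of_im_ne_zero hρ.2.ne').2 hρ.1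
  · obtain ⟨t, rfl⟩ := exists_mul_one_sub_eq a
    have ht : normalizedXi t = 0 := (hxi t).trans ha
    have him := im_ne_zero_of_normalizedXi_eq_zero ht
    rcases lt_or_gt_of_ne him with hneg | hpos
    · refine ⟨1 - t, ⟨?_, by simpa using hneg⟩, by ring⟩
      rw [← normalizedXi_eq_zero_iff_of_im_ne_zero (by simpa using him), normalizedXi_one_sub, ht]
    · exact ⟨t, ⟨(normalizedXi_eq_zero_iff_of_im_ne_zero him).1 ht, hpos⟩, rfl⟩

theorem analyticOrderNatAt_riemannZeta_eq_of_comp {h : ℂ → ℂ}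
    (hxi : ∀ s, normalizedXi s = h (s * (1 - s))) {ρ : ℂ} (hρ : ρ.im ≠ 0) :
    analyticOrderNatAt riemannZeta ρ = analyticOrderNatAt h (ρ * (1 - ρ)) := by
  have hhalf : ρ ≠ 1 / 2 := ne_of_apply_ne Complex.im (by simpa using hρ)
  rw [analyticOrderNatAt, analyticOrderNatAt, analyticOrderAt_riemannZeta_eq hρ, funext hxi,
    analyticOrderAt_comp_mul_one_sub hhalf]

theorem zetaZeroFactor_eq_one_sub_div {s ρ : ℂ} (hρ0 : ρ ≠ 0) (hρ1 : ρ ≠ 1) :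
    zetaZeroFactor s ρ = 1 - s * (1 - s) / (ρ * (1 - ρ)) := by
  have h1 : 1 - ρ ≠ 0 := sub_ne_zero.2 hρ1.symm
  rw [zetaZeroFactor]
  field_simp
  ring

theorem hasProd_zetaZeroFactor (s : ℂ) :
    HasProd (fun i : UpperZetaZeroIndex => zetaZeroFactor s i.1) (normalizedXi s) := by
  obtain ⟨h, hh, hxi⟩ :=
    exists_differentiable_comp_mul_one_sub differentiable_normalizedXi normalizedXi_one_sub
  have h0 : h 0 = 1 := by simpa [normalizedXi] using (hxi 0).symm
  have hgrowth (z : ℂ) (hz : 1 ≤ ‖z‖) : ‖h z‖ ≤ Real.exp (74 * ‖z‖ ^ (3 / 4 : ℝ)) := by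
    obtain ⟨t, rfl⟩ := exists_mul_one_sub_eq z
    exact hxi t ▸ norm_normalizedXi_le hz
  have hprod := hasProd_one_sub_div_zeroIndex hh h0 (by norm_num) (by norm_num) (by norm_num)
    hgrowth (s * (1 - s))
  let e : UpperZetaZeroIndex ≃ ZeroIndex h :=
    Equiv.sigmaCongr ((bijOn_mul_one_sub_upperZetaZeros hxi).equiv _) fun ρ =>
      finCongr (analyticOrderNatAt_riemannZeta_eq_of_comp hxi ρ.2.2.ne')
  rw [← hxi, ← e.hasProd_iff] at hprod
  convert hprod using 2 with i
  have him : (i.1 : ℂ).im ≠ 0 := i.1.2.2.ne'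
  exact zetaZeroFactor_eq_one_sub_div (ne_of_apply_ne Complex.im him)
    (ne_of_apply_ne Complex.im him)

theorem mainTheorem2_general {s : ℂ} (h1 : s ≠ 1) (hs : ∀ n : ℕ, s ≠ -2 * (n + 1)) :
    Multipliable (fun i : UpperZetaZeroIndex => zetaZeroFactor s (i.1 : ℂ)) ∧
      riemannZeta s =
        (Real.pi : ℂ) ^ (s / 2) / (2 * (s - 1) * Complex.Gamma (1 + s / 2)) *
          ∏' i : UpperZetaZeroIndex, zetaZeroFactor s (i.1 : ℂ) := by
  have hprod := hasProd_zetaZeroFactor s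
  have hne : 2 * (s - 1) * Complex.Gamma (1 + s / 2) ≠ 0 :=
    mul_ne_zero (mul_ne_zero two_ne_zero (sub_ne_zero.2 h1)) (Gamma_one_add_half_ne_zero hs)
  refine ⟨hprod.multipliable, ?_⟩
  rw [hprod.tprod_eq, div_mul_eq_mul_div, cpow_mul_normalizedXi h1 hs, mul_div_cancel_left₀ _ hne]

theorem mainTheorem2 (s : ℂ) (hs : ∀ n : ℤ, n ≤ 1 → s ≠ (n : ℂ)) :
    Multipliable (fun i : UpperZetaZeroIndex => zetaZeroFactor s (i.1 : ℂ)) ∧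
      riemannZeta s =
        (Real.pi : ℂ) ^ (s / 2) / (2 * (s - 1) * Complex.Gamma (1 + s / 2)) *
          ∏' i : UpperZetaZeroIndex, zetaZeroFactor s (i.1 : ℂ) :=
  mainTheorem2_general (by simpa using hs 1 le_rfl) fun n => by
    simpa using hs (-2 * (n + 1)) (by lia)
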